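/- Let $\rho\in\mathcal S(\mathbb R^3)$ be real-valued, nonnegative and spherically symmetric with $\int_{\mathbb R^3}\rho\,dx=1$; let $\gamma\in\mathbb R$ and $\mu\ge 0$. Put $$\ell=(\rho,(-\Delta)^{-1}\rho)=\iint \frac{\rho(x)\rho(y)}{4\pi|x-y|}\,dx\,dy,\qquad \rho^\varepsilon(x)=\frac1{\varepsilon^{3}}\,\rho\!\left(\frac x\varepsilon\right)\quad(\varepsilon>0),$$ let $(\cdot,\cdot)$ and $\|\cdot\|$ be the scalar product and norm of $L^2=L^2(\mathbb R^3;\mathbb C)$, and let $U(t)=e^{it\Delta}$ be the free Schrödinger group. Fix $\varepsilon>0$ and $\psi_0^\varepsilon\in H^2(\mathbb R^3)$, and consider the scaled problem $$i\,\partial_t\psi=-\Delta\psi+\Big(-\frac{\varepsilon}{\ell}+\gamma\,\frac{\varepsilon^{2+2\mu}}{\ell^{2+2\mu}}\,|(\rho^\varepsilon,\psi)|^{2\mu}\Big)(\rho^\varepsilon,\psi)\,\rho^\varepsilon,\qquad \psi(0)=\psi_0^\varepsilon ,\tag{1}$$ in its integral form $$\psi(t)=U(t)\psi_0^\varepsilon-i\,\frac{\varepsilon}{\ell}\int_0^t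 U(t-s)\rho^\varepsilon\Big(-1+\gamma\,\frac{\varepsilon^{1+2\mu}|(\rho^\varepsilon,\psi(s))|^{2\mu}}{\ell^{2\mu+1}}\Big)(\rho^\varepsilon,\psi(s))\,ds .\tag{2}$$ **Theorem.** There is a function $\psi^\varepsilon\in C([0,\infty),H^2)\cap C^1([0,\infty),L^2)$ with $\psi^\varepsilon(0)=\psi^\varepsilon_0$ that satisfies (2) for all $t\ge0$, and for every $T>0$ its restriction to $(0,T)$ is the unique solution of (2) on $(0,T)$ in the class $C((0,T),H^2)\cap C^1((0,T),L^2)$. It satisfies the differential equation in (1) for all $t\ge 0$ (with the one-sided derivative at $t=0$). Moreover the mass $M[\psi]=\|\psi\|^2$ and the energy $$E^\varepsilon[\psi]=\|\nabla\psi\|^2-\frac{\varepsilon}{\ell}|(\rho^\varepsilon,\psi)|^2+\frac{\gamma}{\mu+1}\,\frac{\varepsilon^{2+2\mu}}{\ell^{2+2\mu}}\,|(\rho^\varepsilon,\psi)|^{2+2\mu}$$ are conserved: $M[\psi^\varepsilon(t)]=M[\psi_0^\varepsilon]$ and $E^\varepsilon[\psi^\varepsilon(t)]=E^\varepsilon[\psi_0^\varepsilon]$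 for all $t\ge0$. -/

import Mathlib

open MeasureTheory TemperedDistribution FourierTransform
open scoped SchwartzMap LineDeriv Laplacian ENNReal

noncomputable section

namespace ScaledNLS

/-- Euclidean space `ℝ³`. -/
abbrev E3 : Type := EuclideanSpace ℝ (Fin 3)

/-- The complex Hilbert space `L²(ℝ³)`. -/
abbrev L2 : Type := Lp ℂ 2 (volume : Measure E3)

/-! ### Sobolev regularity -/

/-- `u ∈ H²(ℝ³)`. -/
def MemH2 (u : L2) : Prop := MemSobolev 2 2 (u : 𝓢'(E3, ℂ))

/-- `ψ ∈ C(J, H²(ℝ³))`. The topology of `H²` is given by the norm `‖(1 + |D|²) u‖_{L²}`, where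
`besselPotential E3 ℂ 2` is the operator `1 + |D|²`; hence the condition says that
`(1 + |D|²) ψ(t)` is an `L²` function for every `t ∈ J` and depends continuously on `t ∈ J`
in `L²`. -/
def ContinuousOnH2 (ψ : ℝ → L2) (J : Set ℝ) : Prop :=
  ∃ Ψ : ℝ → L2, ContinuousOn Ψ J ∧
    ∀ t ∈ J, besselPotential E3 ℂ 2 (ψ t : 𝓢'(E3, ℂ)) = (Ψ t : 𝓢'(E3, ℂ))

open Classical in
/-- The weak partial derivative `∂ⱼ u` as an element of `L²(ℝ³)` (with value `0` if the
distributional derivative is not an `L²` function, which does not happen on `H²`). -/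
def weakPartial (u : L2) (j : Fin 3) : L2 :=
  if h : ∃ g : L2, ∂_{EuclideanSpace.single j (1 : ℝ)} (u : 𝓢'(E3, ℂ)) = (g : 𝓢'(E3, ℂ)) then
    h.choose
  else 0

theorem MemH2.weakPartial_eq {u : L2} (hu : MemH2 u) (j : Fin 3) :
    ∂_{EuclideanSpace.single j (1 : ℝ)} (u : 𝓢'(E3, ℂ)) = (weakPartial u j : 𝓢'(E3, ℂ)) := by
  have h : ∃ g : L2,
      ∂_{EuclideanSpace.single j (1 : ℝ)} (u : 𝓢'(E3, ℂ)) = (g : 𝓢'(E3, ℂ)) := by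
    rw [← memSobolev_zero_iff]
    exact (MemSobolev.lineDerivOp hu).mono (by norm_num)
  unfold weakPartial
  rw [dif_pos h]
  exact h.choose_spec

/-- `‖∇u‖²_{L²}`. -/
def gradNormSq (u : L2) : ℝ := ∑ j : Fin 3, ‖weakPartial u j‖ ^ 2

/-! ### The free Schrödinger group -/

/-- The function `e^{-i t |k|²}`, with `k = 2πξ` because the Fourier transform used here is
`𝓕 f ξ = ∫ e^{-2πi⟨x,ξ⟩} f x dx`. -/
def freeSymbol (t : ℝ) (ξ : E3) : ℂ :=
  Complex.exp (-Complex.I * ((t * (2 * Real.pi * ‖ξ‖) ^ 2 : ℝ) : ℂ))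

theorem memLp_freeSymbol (t : ℝ) : MemLp (freeSymbol t) ∞ (volume : Measure E3) := by
  refine memLp_top_of_bound (C := 1) ?_ (ae_of_all _ fun ξ ↦ ?_)
  · unfold freeSymbol
    exact Continuous.aestronglyMeasurable (by fun_prop)
  · unfold freeSymbol
    rw [show -Complex.I * ((t * (2 * Real.pi * ‖ξ‖) ^ 2 : ℝ) : ℂ) =
      ((-(t * (2 * Real.pi * ‖ξ‖) ^ 2) : ℝ) : ℂ) * Complex.I by push_cast; ring,
      Complex.norm_exp_ofReal_mul_I]

/-- The free Schrödinger group `U(t) = e^{itΔ}` on `L²(ℝ³)`. -/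
def freeGroup (t : ℝ) (u : L2) : L2 :=
  𝓕⁻ ((((memLp_freeSymbol t).toLp (freeSymbol t) : Lp ℂ ∞ (volume : Measure E3)) •
    (𝓕 u : L2) : L2))

/-! ### The form factor -/

/-- `ρ^ε(x) = ε⁻³ ρ(x/ε)`. -/
def scaledFactor (ρ : 𝓢(E3, ℝ)) (ε : ℝ) (x : E3) : ℝ := 1 / ε ^ 3 * ρ (ε⁻¹ • x)

theorem memLp_scaledFactor (ρ : 𝓢(E3, ℝ)) (ε : ℝ) :
    MemLp (fun x ↦ (scaledFactor ρ ε x : ℂ)) 2 (volume : Measure E3) := by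
  rcases eq_or_ne ε 0 with rfl | hε
  · simp [scaledFactor]
  · have h := ((SchwartzMap.compCLMOfContinuousLinearEquiv ℝ
      (ContinuousLinearEquiv.smulLeft (Units.mk0 ε⁻¹ (inv_ne_zero hε)) : E3 ≃L[ℝ] E3) ρ).memLp 2
      (volume : Measure E3)).const_mul (1 / ε ^ 3)
    exact h.ofReal

/-- `ρ^ε` as an element of `L²(ℝ³)`. -/
def scaledL2 (ρ : 𝓢(E3, ℝ)) (ε : ℝ) : L2 := (memLp_scaledFactor ρ ε).toLp _

/-- The scalar product `(ρ^ε, u)` in `L²(ℝ³)`. -/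
def pairing (ρ : 𝓢(E3, ℝ)) (ε : ℝ) (u : L2) : ℂ := inner ℂ (scaledL2 ρ ε) u

/-- The fundamental solution `G(x) = 1 / (4π|x|)` of `-Δ` on `ℝ³`. -/
def newtonKernel (x : E3) : ℝ := 1 / (4 * Real.pi * ‖x‖)

/-- `ℓ = (ρ, (-Δ)⁻¹ ρ)`, where `(-Δ)⁻¹ ρ = G * ρ`. -/
def ell (ρ : 𝓢(E3, ℝ)) : ℝ := ∫ x : E3, ρ x * ∫ y : E3, newtonKernel (x - y) * ρ y

/-! ### The scaled problem -/

/-- `(-1 + γ ε^{1+2μ} |z|^{2μ} / ℓ^{2μ+1}) z`, to be evaluated at `z = (ρ^ε, ψ)`. -/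
def nonlinearity (ρ : 𝓢(E3, ℝ)) (γ μ ε : ℝ) (z : ℂ) : ℂ :=
  ((-1 + γ * (ε ^ (1 + 2 * μ) * ‖z‖ ^ (2 * μ) / ell ρ ^ (2 * μ + 1)) : ℝ) : ℂ) * z

/-- `ψ` is a solution, on the set of times `J`, of the integral form
`ψ(t) = U(t)ψ₀ - i (ε/ℓ) ∫₀ᵗ U(t-s)ρ^ε (-1 + γ ε^{1+2μ} |(ρ^ε,ψ(s))|^{2μ} / ℓ^{2μ+1}) (ρ^ε,ψ(s)) ds`
of the scaled problem, in the class `C(J, H²) ∩ C¹(J, L²)`. -/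
structure IsSolutionOn (ρ : 𝓢(E3, ℝ)) (γ μ ε : ℝ) (ψ₀ : L2) (J : Set ℝ) (ψ : ℝ → L2) :
    Prop where
  continuousOnH2 : ContinuousOnH2 ψ J
  contDiffOn : ContDiffOn ℝ 1 ψ J
  intervalIntegrable : ∀ t ∈ J, IntervalIntegrable
    (fun s ↦ nonlinearity ρ γ μ ε (pairing ρ ε (ψ s)) • freeGroup (t - s) (scaledL2 ρ ε))
    volume 0 t
  integral_eq : ∀ t ∈ J, ψ t = freeGroup t ψ₀ - (Complex.I * ((ε / ell ρ : ℝ) : ℂ)) •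
    ∫ s in (0 : ℝ)..t,
      nonlinearity ρ γ μ ε (pairing ρ ε (ψ s)) • freeGroup (t - s) (scaledL2 ρ ε)

/-- The mass `M[u] = ‖u‖²`. -/
def mass (u : L2) : ℝ := ‖u‖ ^ 2

/-- The energy
`E^ε[u] = ‖∇u‖² - (ε/ℓ) |(ρ^ε,u)|² + γ/(μ+1) ε^{2+2μ}/ℓ^{2+2μ} |(ρ^ε,u)|^{2+2μ}`. -/
def energy (ρ : 𝓢(E3, ℝ)) (γ μ ε : ℝ) (u : L2) : ℝ :=
  gradNormSq u - ε / ell ρ * ‖pairing ρ ε u‖ ^ 2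
    + γ / (μ + 1) * (ε ^ (2 + 2 * μ) / ell ρ ^ (2 + 2 * μ)) * ‖pairing ρ ε u‖ ^ (2 + 2 * μ)

end ScaledNLS

end

/-! The interaction has rank one: it sees `ψ` only through the scalar `q = (ρ^ε, ψ)` and acts along
the fixed vector `ρ^ε`. Let `A` be the Fourier multiplier `(1 + ‖ξ‖²)⁻¹` (`resolvent`), whose range
is exactly `H²`. Write `ρ^ε = A R` and `ψ(t) = A U(t) Φ(t)`. The problem becomes `Φ' = -i p(t) U(-t)
R` in `L²`, where `p` is a real multiple of `q`: no unbounded operator is left, and the field is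
locally Lipschitz in `Φ`.

Existence: composing the nonlinearity with a retraction onto a ball makes the field bounded and
globally Lipschitz, so Picard-Lindelöf gives a global curve (`exists_profile`). The retracted
coupling is still a real multiple of `q`, hence mass is conserved (`norm_resolvent_freeCLM_eq`);
Cauchy-Schwarz then keeps `q` in the ball, and the retraction was the identity all along
(`exists_profile_coupling`). The sign of `γ` plays no role.

Regularity is read off from `Φ ∈ C¹(L²)` (`hasDerivAt_resolvent_freeCLM`). Uniqueness is Gronwall
for the Duhamel formula pulled back by `U(-t)`, in `L²` alone (`eq_freeCLM_of_duhamel`). Energy is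
conserved because the derivatives of the gradient term and of the potential cancel
(`gradNormSq_add_eq`). -/

noncomputable section

namespace ScaledNLS

open Filter Topology NNReal BoundedContinuousFunction

/-! ### Fourier multipliers on `L²` -/

/-- Multiplication of an `L²` function by the bounded function `m`, on the Fourier side. -/
def multiplier (m : E3 →ᵇ ℂ) : L2 →L[ℂ] L2 :=
  LinearMap.mkContinuous
    { toFun := fun u ↦ 𝓕⁻ ((((m.memLp_top).toLp m : Lp ℂ ∞ (volume : Measure E3)) •
        (𝓕 u : L2) : L2))
      map_add' := fun u v ↦ by
        rw [FourierTransform.fourier_add, Lp.add_smul, FourierTransform.fourierInv_add]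
      map_smul' := fun c u ↦ by
        rw [FourierTransform.fourier_smul, ← Lp.smul_comm, FourierTransform.fourierInv_smul]
        rfl }
    ‖((m.memLp_top).toLp m : Lp ℂ ∞ (volume : Measure E3))‖ fun u ↦ by
      refine ((Lp.fourierTransformₗᵢ E3 ℂ).symm.norm_map _).trans_le ?_
      refine (Lp.norm_smul_le _ _).trans_eq ?_
      rw [Lp.norm_fourier_eq]

theorem multiplier_apply (m : E3 →ᵇ ℂ) (u : L2) :
    multiplier m u = 𝓕⁻ ((((m.memLp_top).toLp m : Lp ℂ ∞ (volume : Measure E3)) •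
      (𝓕 u : L2) : L2)) := rfl

theorem fourier_multiplier_ae (m : E3 →ᵇ ℂ) (u : L2) :
    (𝓕 (multiplier m u) : L2) =ᵐ[volume] fun ξ ↦ m ξ * (𝓕 u : L2) ξ := by
  rw [multiplier_apply, fourier_fourierInv_eq]
  filter_upwards [Lp.coeFn_lpSMul (r := 2) (m.memLp_top.toLp m : Lp ℂ ∞ (volume : Measure E3))
    (𝓕 u : L2), m.memLp_top.coeFn_toLp (μ := (volume : Measure E3))] with ξ h1 h2
  rw [h1, Pi.smul_apply', h2, smul_eq_mul]

theorem eq_of_fourier_ae {u v : L2} (h : (𝓕 u : L2) =ᵐ[volume] (𝓕 v : L2)) : u = v :=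
  (Lp.fourierTransformₗᵢ E3 ℂ).injective (Lp.ext h)

theorem multiplier_multiplier (m n : E3 →ᵇ ℂ) (u : L2) :
    multiplier m (multiplier n u) = multiplier (m * n) u := by
  apply eq_of_fourier_ae
  filter_upwards [fourier_multiplier_ae m (multiplier n u), fourier_multiplier_ae n u,
    fourier_multiplier_ae (m * n) u] with ξ h1 h2 h3
  rw [h1, h2, h3, BoundedContinuousFunction.mul_apply, mul_assoc]

theorem multiplier_one (u : L2) : multiplier 1 u = u := by
  apply eq_of_fourier_ae
  filter_upwards [fourier_multiplier_ae 1 u] with ξ h1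
  rw [h1, BoundedContinuousFunction.coe_one, Pi.one_apply, one_mul]

theorem multiplier_add (m n : E3 →ᵇ ℂ) (u : L2) :
    multiplier (m + n) u = multiplier m u + multiplier n u := by
  apply eq_of_fourier_ae
  rw [FourierTransform.fourier_add]
  filter_upwards [fourier_multiplier_ae m u, fourier_multiplier_ae n u,
    fourier_multiplier_ae (m + n) u, Lp.coeFn_add (𝓕 (multiplier m u) : L2) (𝓕 (multiplier n u))]
    with ξ h1 h2 h3 h4
  rw [h3, h4, Pi.add_apply, h1, h2, BoundedContinuousFunction.add_apply, add_mul]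

theorem multiplier_smul (c : ℂ) (m : E3 →ᵇ ℂ) (u : L2) :
    multiplier (c • m) u = c • multiplier m u := by
  apply eq_of_fourier_ae
  rw [FourierTransform.fourier_smul]
  filter_upwards [fourier_multiplier_ae m u, fourier_multiplier_ae (c • m) u,
    Lp.coeFn_smul c (𝓕 (multiplier m u) : L2)] with ξ h1 h2 h3
  rw [h2, h3, Pi.smul_apply, h1, BoundedContinuousFunction.smul_apply, smul_eq_mul, smul_eq_mul,
    mul_assoc]

theorem inner_multiplier_multiplier (m n : E3 →ᵇ ℂ) (u v : L2) :
    inner ℂ (multiplier m u) (multiplier n v) =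
      ∫ ξ, (n ξ * (starRingEnd ℂ) (m ξ)) * inner ℂ ((𝓕 u : L2) ξ) ((𝓕 v : L2) ξ) := by
  rw [← Lp.inner_fourier_eq, L2.inner_def]
  refine integral_congr_ae ?_
  filter_upwards [fourier_multiplier_ae m u, fourier_multiplier_ae n v] with ξ h1 h2
  rw [h1, h2]
  simp only [RCLike.inner_apply, map_mul]
  ring

/-- By Plancherel the pairing depends only on the product of one symbol with the conjugate of the
other, so factors may be moved between the slots. Unitarity of the group, symmetry of `-Δ` and the
gradient identity are all instances. -/
theorem inner_multiplier_congr {m n m' n' : E3 →ᵇ ℂ}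
    (h : ∀ ξ, n ξ * (starRingEnd ℂ) (m ξ) = n' ξ * (starRingEnd ℂ) (m' ξ)) (u v : L2) :
    (inner ℂ (multiplier m u) (multiplier n v) : ℂ) =
      inner ℂ (multiplier m' u) (multiplier n' v) := by
  simp only [inner_multiplier_multiplier, h]

theorem norm_sq_multiplier (m : E3 →ᵇ ℂ) (u : L2) :
    ‖multiplier m u‖ ^ 2 = ∫ ξ, ‖m ξ‖ ^ 2 * ‖(𝓕 u : L2) ξ‖ ^ 2 := by
  have h := inner_multiplier_multiplier m m u u
  rw [inner_self_eq_norm_sq_to_K] at h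
  have h2 : (∫ ξ, (m ξ * (starRingEnd ℂ) (m ξ)) * inner ℂ ((𝓕 u : L2) ξ) ((𝓕 u : L2) ξ)) =
      ((∫ ξ, ‖m ξ‖ ^ 2 * ‖(𝓕 u : L2) ξ‖ ^ 2 : ℝ) : ℂ) := by
    rw [← integral_complex_ofReal]
    refine integral_congr_ae (ae_of_all _ fun ξ ↦ ?_)
    simp only [inner_self_eq_norm_sq_to_K, Complex.mul_conj']
    push_cast
    rfl
  rw [h2] at h
  apply Complex.ofReal_injective
  rw [← h]
  push_cast
  rfl

/-- Uniformly bounded multipliers that converge pointwise converge strongly. -/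
theorem tendsto_multiplier {ι : Type*} {l : Filter ι} [l.IsCountablyGenerated]
    {F : ι → E3 →ᵇ ℂ} {m : E3 →ᵇ ℂ} {C : ℝ} (hC : ∀ i ξ, ‖F i ξ‖ ≤ C)
    (hF : ∀ ξ, Tendsto (fun i ↦ F i ξ) l (𝓝 (m ξ))) (u : L2) :
    Tendsto (fun i ↦ multiplier (F i) u) l (𝓝 (multiplier m u)) := by
  rw [tendsto_iff_norm_sub_tendsto_zero]
  have key : Tendsto (fun i ↦ ‖multiplier (F i) u - multiplier m u‖ ^ 2) l (𝓝 0) := by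
    have hsub : ∀ i, multiplier (F i) u - multiplier m u = multiplier (F i + (-1 : ℂ) • m) u := by
      intro i
      rw [multiplier_add, multiplier_smul, neg_one_smul, sub_eq_add_neg]
    simp only [hsub, norm_sq_multiplier]
    have hz : (0 : ℝ) = ∫ ξ, (0 : ℝ) * ‖(𝓕 u : L2) ξ‖ ^ 2 := by simp
    rw [hz]
    have hint : Integrable (fun ξ ↦ ‖(𝓕 u : L2) ξ‖ ^ 2) (volume : Measure E3) :=
      (Lp.memLp (𝓕 u : L2)).integrable_norm_pow (by norm_num)
    refine tendsto_integral_filter_of_dominated_convergence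
      (fun ξ ↦ (C + ‖m‖) ^ 2 * ‖(𝓕 u : L2) ξ‖ ^ 2) (Eventually.of_forall fun i ↦ ?_)
      (Eventually.of_forall fun i ↦ ae_of_all _ fun ξ ↦ ?_) (hint.const_mul _)
      (ae_of_all _ fun ξ ↦ ?_)
    · exact ((F i + (-1 : ℂ) • m).continuous.norm.pow 2).aestronglyMeasurable.mul
        hint.aestronglyMeasurable
    · rw [Real.norm_of_nonneg (by positivity)]
      gcongr
      rw [BoundedContinuousFunction.add_apply, BoundedContinuousFunction.smul_apply, neg_one_smul]
      refine (norm_add_le _ _).trans ?_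
      rw [norm_neg]
      exact add_le_add (hC i ξ) (m.norm_coe_le_norm ξ)
    · refine Tendsto.mul_const _ ?_
      have := ((hF ξ).add_const (-(m ξ))).norm.pow 2
      simpa using this
  have := key.sqrt
  simpa [Real.sqrt_sq] using this

theorem toTemperedDistribution_multiplier {m : E3 →ᵇ ℂ} (hm : (m : E3 → ℂ).HasTemperateGrowth)
    (u : L2) :
    (multiplier m u : 𝓢'(E3, ℂ)) = fourierMultiplierCLM ℂ (m : E3 → ℂ) (u : 𝓢'(E3, ℂ)) := by
  rw [multiplier_apply, ← Lp.fourierInv_toTemperedDistribution_eq,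
    Lp.toTemperedDistribution_smul_eq hm m.memLp_top, ← Lp.fourier_toTemperedDistribution_eq,
    fourierMultiplierCLM_apply]

theorem toTemperedDistribution_injective {u v : L2}
    (h : (u : 𝓢'(E3, ℂ)) = (v : 𝓢'(E3, ℂ))) : u = v :=
  LinearMap.ker_eq_bot.mp
    (Lp.ker_toTemperedDistributionCLM_eq_bot (F := ℂ) (μ := (volume : Measure E3)) (p := 2)) h

/-! ### The symbols -/

/-- The exponent stays unsimplified as `-2 / 2` to agree definitionally with the symbol of
`besselPotential E3 ℂ (-2)`. -/
theorem hasTemperateGrowth_inv_one_add_norm_sq :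
    (fun ξ : E3 ↦ (((1 + ‖ξ‖ ^ 2) ^ (-2 / 2 : ℝ) : ℝ) : ℂ)).HasTemperateGrowth := by
  fun_prop

/-- The symbol of the inverse of `besselPotential E3 ℂ 2`. -/
def resolventSymbol : E3 →ᵇ ℂ :=
  BoundedContinuousFunction.ofNormedAddCommGroup
    (fun ξ ↦ (((1 + ‖ξ‖ ^ 2) ^ (-2 / 2 : ℝ) : ℝ) : ℂ))
    hasTemperateGrowth_inv_one_add_norm_sq.1.continuous 1 fun ξ ↦ by
      rw [Complex.norm_real, Real.norm_of_nonneg (by positivity)]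
      exact Real.rpow_le_one_of_one_le_of_nonpos (by simp) (by norm_num)

theorem resolventSymbol_apply (ξ : E3) :
    resolventSymbol ξ = (((1 + ‖ξ‖ ^ 2)⁻¹ : ℝ) : ℂ) := by
  change (((1 + ‖ξ‖ ^ 2) ^ (-2 / 2 : ℝ) : ℝ) : ℂ) = _
  rw [show (-2 / 2 : ℝ) = -1 by norm_num, Real.rpow_neg_one]

theorem hasTemperateGrowth_resolventSymbol :
    (resolventSymbol : E3 → ℂ).HasTemperateGrowth :=
  hasTemperateGrowth_inv_one_add_norm_sq

theorem inv_one_add_sq_mul_sq_le (r : ℝ) : (1 + r ^ 2)⁻¹ * r ^ 2 ≤ 1 := by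
  rw [inv_mul_le_iff₀ (by positivity)]
  linarith

/-- The symbol of `-Δ` times `resolventSymbol`. -/
def laplaceSymbol : E3 →ᵇ ℂ :=
  BoundedContinuousFunction.ofNormedAddCommGroup
    (fun ξ ↦ resolventSymbol ξ * (((2 * Real.pi * ‖ξ‖) ^ 2 : ℝ) : ℂ))
    -- The Bessel potential is normalised without `2π` and the Laplacian with it, whence this bound.
    (by fun_prop) ((2 * Real.pi) ^ 2) fun ξ ↦ by
      rw [resolventSymbol_apply, ← Complex.ofReal_mul, Complex.norm_real,
        Real.norm_of_nonneg (by positivity)]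
      have := mul_le_mul_of_nonneg_left (inv_one_add_sq_mul_sq_le ‖ξ‖)
        (sq_nonneg (2 * Real.pi))
      linarith

theorem laplaceSymbol_apply (ξ : E3) :
    laplaceSymbol ξ = resolventSymbol ξ * (((2 * Real.pi * ‖ξ‖) ^ 2 : ℝ) : ℂ) := rfl

/-- The symbol of `∂ⱼ` times `resolventSymbol`. -/
def partialSymbol (j : Fin 3) : E3 →ᵇ ℂ :=
  BoundedContinuousFunction.ofNormedAddCommGroup
    (fun ξ ↦ resolventSymbol ξ * ((2 * Real.pi * Complex.I) * ((ξ j : ℝ) : ℂ)))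
    (by fun_prop) (2 * Real.pi) fun ξ ↦ by
      have h1 : |ξ j| ≤ ‖ξ‖ := by simpa using PiLp.norm_apply_le ξ j
      have h2 : (1 + ‖ξ‖ ^ 2)⁻¹ * |ξ j| ≤ 1 := by
        rw [inv_mul_le_iff₀ (by positivity)]
        nlinarith [sq_nonneg (‖ξ‖ - 1), norm_nonneg ξ]
      rw [resolventSymbol_apply, norm_mul, norm_mul, norm_mul, norm_mul, Complex.norm_I,
        Complex.norm_real, Complex.norm_real, Complex.norm_real,
        Real.norm_of_nonneg (by positivity : (0 : ℝ) ≤ (1 + ‖ξ‖ ^ 2)⁻¹),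
        Real.norm_of_nonneg Real.pi_pos.le, Complex.norm_two, Real.norm_eq_abs]
      have := mul_le_mul_of_nonneg_left h2 Real.two_pi_pos.le
      linarith

theorem partialSymbol_apply (j : Fin 3) (ξ : E3) : partialSymbol j ξ =
    resolventSymbol ξ * ((2 * Real.pi * Complex.I) * ((ξ j : ℝ) : ℂ)) := rfl

theorem freeSymbol_eq (t : ℝ) (ξ : E3) : freeSymbol t ξ =
    Complex.exp (Complex.I * ((-(t * (2 * Real.pi * ‖ξ‖) ^ 2) : ℝ) : ℂ)) := by
  unfold freeSymbol
  congr 1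
  push_cast
  ring

theorem norm_freeSymbol (t : ℝ) (ξ : E3) : ‖freeSymbol t ξ‖ = 1 := by
  rw [freeSymbol_eq, Complex.norm_exp_I_mul_ofReal]

/-- `freeSymbol t` as a bounded continuous function. -/
def boundedFreeSymbol (t : ℝ) : E3 →ᵇ ℂ :=
  BoundedContinuousFunction.ofNormedAddCommGroup (freeSymbol t)
    (by unfold freeSymbol; fun_prop) 1 fun ξ ↦ (norm_freeSymbol t ξ).le

theorem boundedFreeSymbol_apply (t : ℝ) (ξ : E3) :
    boundedFreeSymbol t ξ = freeSymbol t ξ := rfl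

/-! ### The operators -/

/-- The free group as a family of bounded operators. -/
def freeCLM (t : ℝ) : L2 →L[ℂ] L2 := multiplier (boundedFreeSymbol t)

/-- The inverse of `besselPotential E3 ℂ 2` on `L²`. -/
def resolvent : L2 →L[ℂ] L2 := multiplier resolventSymbol

/-- The bounded operator `-Δ ∘ resolvent` on `L²`. -/
def laplaceResolvent : L2 →L[ℂ] L2 := multiplier laplaceSymbol

theorem freeSymbol_add (s t : ℝ) (ξ : E3) :
    freeSymbol (s + t) ξ = freeSymbol s ξ * freeSymbol t ξ := by
  unfold freeSymbol
  rw [← Complex.exp_add]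
  congr 1
  push_cast
  ring

theorem freeCLM_add (s t : ℝ) (u : L2) : freeCLM (s + t) u = freeCLM s (freeCLM t u) := by
  unfold freeCLM
  rw [multiplier_multiplier]
  congr 2
  ext ξ
  exact freeSymbol_add s t ξ

theorem freeCLM_zero (u : L2) : freeCLM 0 u = u := by
  have h : boundedFreeSymbol 0 = 1 := by
    ext ξ
    simp [boundedFreeSymbol_apply, freeSymbol]
  rw [freeCLM, h, multiplier_one]

theorem inner_freeCLM (t : ℝ) (u v : L2) :
    (inner ℂ (freeCLM t u) (freeCLM t v) : ℂ) = inner ℂ u v := by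
  have h := inner_multiplier_congr (m := boundedFreeSymbol t) (n := boundedFreeSymbol t)
    (m' := 1) (n' := 1) (fun ξ ↦ by
      simp [Complex.mul_conj', boundedFreeSymbol_apply, norm_freeSymbol]) u v
  rwa [multiplier_one, multiplier_one] at h

theorem freeCLM_resolvent (t : ℝ) (u : L2) :
    freeCLM t (resolvent u) = resolvent (freeCLM t u) := by
  simp only [freeCLM, resolvent, multiplier_multiplier, mul_comm]

theorem freeCLM_laplaceResolvent (t : ℝ) (u : L2) :
    freeCLM t (laplaceResolvent u) = laplaceResolvent (freeCLM t u) := by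
  simp only [freeCLM, laplaceResolvent, multiplier_multiplier, mul_comm]

theorem inner_resolvent_laplaceResolvent (u v : L2) :
    (inner ℂ (resolvent u) (laplaceResolvent v) : ℂ) =
      inner ℂ (laplaceResolvent u) (resolvent v) :=
  inner_multiplier_congr (fun ξ ↦ by
    simp only [laplaceSymbol_apply, resolventSymbol_apply, map_mul, Complex.conj_ofReal]
    ring) u v

theorem continuous_freeCLM (u : L2) : Continuous fun t ↦ freeCLM t u := by
  rw [continuous_iff_continuousAt]
  intro t
  refine tendsto_multiplier (C := 1) (fun s ξ ↦ (norm_freeSymbol s ξ).le) (fun ξ ↦ ?_) u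
  have : Continuous fun s ↦ freeSymbol s ξ := by unfold freeSymbol; fun_prop
  exact this.tendsto t

theorem hasDerivAt_freeSymbol (t : ℝ) (ξ : E3) : HasDerivAt (fun s ↦ freeSymbol s ξ)
    (-Complex.I * (((2 * Real.pi * ‖ξ‖) ^ 2 : ℝ) : ℂ) * freeSymbol t ξ) t := by
  unfold freeSymbol
  have h : HasDerivAt (fun s : ℝ ↦ -Complex.I * ((s * (2 * Real.pi * ‖ξ‖) ^ 2 : ℝ) : ℂ))
      (-Complex.I * ((1 * (2 * Real.pi * ‖ξ‖) ^ 2 : ℝ) : ℂ)) t :=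
    (((hasDerivAt_id t).mul_const _).ofReal_comp).const_mul _
  convert h.cexp using 1
  rw [one_mul, mul_comm]

theorem norm_freeSymbol_sub_le (s t : ℝ) (ξ : E3) :
    ‖freeSymbol s ξ - freeSymbol t ξ‖ ≤ |s - t| * (2 * Real.pi * ‖ξ‖) ^ 2 := by
  have h : freeSymbol s ξ - freeSymbol t ξ =
      freeSymbol t ξ * (freeSymbol (s - t) ξ - 1) := by
    rw [mul_sub, ← freeSymbol_add, mul_one, add_sub_cancel]
  rw [h, norm_mul, norm_freeSymbol, one_mul, freeSymbol_eq]
  refine Real.norm_exp_I_mul_ofReal_sub_one_le.trans_eq ?_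
  rw [norm_neg, norm_mul, Real.norm_eq_abs, Real.norm_of_nonneg (by positivity)]

/-- The difference quotients are multipliers; `|e^{ia} - 1| ≤ |a|` bounds their symbols by
`|laplaceSymbol|`, uniformly in the increment, so pointwise convergence gives strong convergence. -/
theorem hasDerivAt_freeCLM_resolvent (t : ℝ) (u : L2) :
    HasDerivAt (fun s ↦ freeCLM s (resolvent u))
      (-Complex.I • laplaceResolvent (freeCLM t u)) t := by
  rw [hasDerivAt_iff_tendsto_slope_zero]
  have h1 : ∀ h : ℝ, h⁻¹ • (freeCLM (t + h) (resolvent u) - freeCLM t (resolvent u)) =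
      multiplier (((h⁻¹ : ℝ) : ℂ) • ((boundedFreeSymbol (t + h) +
        (-1 : ℂ) • boundedFreeSymbol t) * resolventSymbol)) u := by
    intro h
    rw [multiplier_smul, ← multiplier_multiplier, multiplier_add, multiplier_smul, neg_one_smul,
      ← sub_eq_add_neg, Complex.coe_smul]
    rfl
  have h2 : -Complex.I • laplaceResolvent (freeCLM t u) =
      multiplier ((-Complex.I) • (laplaceSymbol * boundedFreeSymbol t)) u := by
    rw [multiplier_smul, ← multiplier_multiplier]
    rfl
  simp only [h1]
  rw [h2]
  refine tendsto_multiplier (C := (2 * Real.pi) ^ 2) (fun h ξ ↦ ?_) (fun ξ ↦ ?_) u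
  · have hv : (((h⁻¹ : ℝ) : ℂ) • ((boundedFreeSymbol (t + h) +
        (-1 : ℂ) • boundedFreeSymbol t) * resolventSymbol)) ξ =
        ((h⁻¹ : ℝ) : ℂ) * ((freeSymbol (t + h) ξ - freeSymbol t ξ) * resolventSymbol ξ) := by
      simp [boundedFreeSymbol_apply, sub_eq_add_neg]
    rw [hv, norm_mul, norm_mul, Complex.norm_real, norm_inv, Real.norm_eq_abs]
    have hd := norm_freeSymbol_sub_le (t + h) t ξ
    rw [add_sub_cancel_left] at hd
    have hl : ‖laplaceSymbol ξ‖ ≤ (2 * Real.pi) ^ 2 :=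
      BoundedContinuousFunction.norm_ofNormedAddCommGroup_le _ (by positivity) _ |>.trans'
        (BoundedContinuousFunction.norm_coe_le_norm _ ξ)
    rw [laplaceSymbol_apply, norm_mul, Complex.norm_real,
      Real.norm_of_nonneg (sq_nonneg (2 * Real.pi * ‖ξ‖))] at hl
    -- The uniform bound is required for every increment; at `h = 0` the convention `0⁻¹ = 0` makes
    -- the quotient vanish.
    rcases eq_or_ne h 0 with rfl | hh
    · simp only [abs_zero, inv_zero, zero_mul]
      positivity
    · calc |h|⁻¹ * (‖freeSymbol (t + h) ξ - freeSymbol t ξ‖ * ‖resolventSymbol ξ‖)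
          ≤ |h|⁻¹ * ((|h| * (2 * Real.pi * ‖ξ‖) ^ 2) * ‖resolventSymbol ξ‖) := by gcongr
        _ = ‖resolventSymbol ξ‖ * (2 * Real.pi * ‖ξ‖) ^ 2 := by
          have := abs_pos.mpr hh
          field_simp
        _ ≤ _ := hl
  · have h := ((hasDerivAt_iff_tendsto_slope_zero.mp (hasDerivAt_freeSymbol t ξ)).mul_const
      (resolventSymbol ξ))
    refine (h.congr fun s ↦ ?_).trans_eq ?_
    · simp only [Complex.real_smul, BoundedContinuousFunction.smul_apply,
        BoundedContinuousFunction.mul_apply, BoundedContinuousFunction.add_apply,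
        boundedFreeSymbol_apply, smul_eq_mul]
      ring
    · congr 1
      simp only [BoundedContinuousFunction.smul_apply, BoundedContinuousFunction.mul_apply,
        laplaceSymbol_apply, boundedFreeSymbol_apply, smul_eq_mul]
      ring

/-! ### Relation to tempered distributions -/

theorem toTemperedDistribution_resolvent (u : L2) :
    (resolvent u : 𝓢'(E3, ℂ)) = besselPotential E3 ℂ (-2) (u : 𝓢'(E3, ℂ)) :=
  toTemperedDistribution_multiplier hasTemperateGrowth_resolventSymbol u

theorem besselPotential_resolvent (u : L2) :
    besselPotential E3 ℂ 2 (resolvent u : 𝓢'(E3, ℂ)) = (u : 𝓢'(E3, ℂ)) := by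
  rw [toTemperedDistribution_resolvent, besselPotential_besselPotential_apply]
  simp

theorem MemH2.exists_resolvent_eq {u : L2} (hu : MemH2 u) : ∃ v, resolvent v = u := by
  obtain ⟨v, hv⟩ := hu
  refine ⟨v, toTemperedDistribution_injective ?_⟩
  rw [toTemperedDistribution_resolvent, besselPotential_neg_apply_eq_iff]
  exact hv

theorem laplacian_resolvent (u : L2) :
    -Δ (resolvent u : 𝓢'(E3, ℂ)) = (laplaceResolvent u : 𝓢'(E3, ℂ)) := by
  have hg : (laplaceSymbol : E3 → ℂ).HasTemperateGrowth := by
    change Function.HasTemperateGrowth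
      (fun ξ : E3 ↦ (((1 + ‖ξ‖ ^ 2) ^ (-2 / 2 : ℝ) : ℝ) : ℂ) *
        (((2 * Real.pi * ‖ξ‖) ^ 2 : ℝ) : ℂ))
    simp only [mul_pow]
    fun_prop
  rw [laplaceResolvent, toTemperedDistribution_multiplier hg, resolvent,
    toTemperedDistribution_multiplier hasTemperateGrowth_resolventSymbol,
    laplacian_eq_fourierMultiplierCLM,
    fourierMultiplierCLM_fourierMultiplierCLM_apply hasTemperateGrowth_resolventSymbol
      (by fun_prop), neg_smul, neg_neg, ← Complex.coe_smul, ← _root_.smul_apply,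
    ← fourierMultiplierCLM_smul (by
      exact hasTemperateGrowth_resolventSymbol.mul (by fun_prop))]
  congr 2
  ext ξ
  simp only [Pi.smul_apply, Pi.mul_apply, smul_eq_mul, laplaceSymbol_apply]
  push_cast
  ring

theorem memH2_resolvent (u : L2) : MemH2 (resolvent u) := ⟨u, besselPotential_resolvent u⟩

/-- The chosen representative is pinned down by injectivity of `L²` into tempered distributions. -/
theorem weakPartial_resolvent (u : L2) (j : Fin 3) :
    weakPartial (resolvent u) j = multiplier (partialSymbol j) u := by
  apply toTemperedDistribution_injective
  have hg : (partialSymbol j : E3 → ℂ).HasTemperateGrowth := by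
    change Function.HasTemperateGrowth
      (fun ξ : E3 ↦ (((1 + ‖ξ‖ ^ 2) ^ (-2 / 2 : ℝ) : ℝ) : ℂ) *
        ((2 * Real.pi * Complex.I) * ((EuclideanSpace.proj (𝕜 := ℝ) j ξ : ℝ) : ℂ)))
    fun_prop
  rw [← (memH2_resolvent u).weakPartial_eq j, toTemperedDistribution_multiplier hg, resolvent,
    toTemperedDistribution_multiplier hasTemperateGrowth_resolventSymbol,
    lineDeriv_eq_fourierMultiplierCLM,
    fourierMultiplierCLM_fourierMultiplierCLM_apply hasTemperateGrowth_resolventSymbol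
      (by fun_prop), ← _root_.smul_apply,
    ← fourierMultiplierCLM_smul (by
      exact hasTemperateGrowth_resolventSymbol.mul (by fun_prop))]
  congr 2
  ext ξ
  simp only [Pi.smul_apply, Pi.mul_apply, smul_eq_mul, partialSymbol_apply,
    EuclideanSpace.inner_single_right]
  simp
  ring

/-- Integration by parts on the Fourier side: the squares `|2πi ξⱼ|²` add up to `(2π‖ξ‖)²`. -/
theorem gradNormSq_resolvent (u : L2) :
    gradNormSq (resolvent u) = (inner ℂ (resolvent u) (laplaceResolvent u) : ℂ).re := by
  have h1 : ∀ j, ((‖multiplier (partialSymbol j) u‖ ^ 2 : ℝ) : ℂ) =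
      inner ℂ u (multiplier (star (partialSymbol j) * partialSymbol j) u) := by
    intro j
    have h := inner_multiplier_congr (m := partialSymbol j) (n := partialSymbol j)
      (m' := 1) (n' := star (partialSymbol j) * partialSymbol j)
      (fun ξ ↦ by simp [mul_comm]) u u
    rw [multiplier_one, inner_self_eq_norm_sq_to_K] at h
    rw [← h]
    push_cast
    rfl
  have h2 := inner_multiplier_congr (m := resolventSymbol) (n := laplaceSymbol)
      (m' := 1) (n' := star (partialSymbol 0) * partialSymbol 0 +
        (star (partialSymbol 1) * partialSymbol 1 + star (partialSymbol 2) * partialSymbol 2))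
      (fun ξ ↦ by
        have hn : ((‖ξ‖ ^ 2 : ℝ) : ℂ) = (ξ 0 : ℂ) ^ 2 + ((ξ 1 : ℂ) ^ 2 + (ξ 2 : ℂ) ^ 2) := by
          rw [EuclideanSpace.real_norm_sq_eq, Fin.sum_univ_three]
          push_cast
          ring
        simp only [laplaceSymbol_apply, partialSymbol_apply, resolventSymbol_apply,
          BoundedContinuousFunction.add_apply, BoundedContinuousFunction.mul_apply,
          BoundedContinuousFunction.star_apply, BoundedContinuousFunction.coe_one, Pi.one_apply, mul_pow,
          Complex.ofReal_mul, hn, map_one, map_mul, Complex.conj_ofReal, Complex.conj_I,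
          RCLike.star_def, Complex.ofReal_pow, Complex.ofReal_ofNat, map_ofNat]
        ring_nf
        simp only [Complex.I_sq]
        ring) u u
  rw [multiplier_one, multiplier_add, multiplier_add, inner_add_right, inner_add_right, ← h1,
    ← h1, ← h1] at h2
  rw [resolvent, laplaceResolvent, h2, ← resolvent]
  simp only [gradNormSq, weakPartial_resolvent, Fin.sum_univ_three, ← Complex.ofReal_add,
    Complex.ofReal_re]
  ring

/-! ### Ordinary differential equations in Banach spaces -/

/-- A bounded vector field that is Lipschitz in space and continuous in time has global integral
curves. -/
theorem exists_hasDerivAt_of_lipschitz_of_bounded {E : Type*} [NormedAddCommGroup E]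
    [NormedSpace ℝ E] [CompleteSpace E] {f : ℝ → E → E} {K M : ℝ≥0}
    (hK : ∀ t, LipschitzWith K (f t)) (hc : ∀ x, Continuous (f · x)) (hM : ∀ t x, ‖f t x‖ ≤ M)
    (x₀ : E) : ∃ α : ℝ → E, α 0 = x₀ ∧ ∀ t, HasDerivAt α (f t (α t)) t := by
  have hloc : ∀ n : ℕ, ∃ α : ℝ → E, α 0 = x₀ ∧
      ∀ t ∈ Set.Icc (-(n : ℝ)) n, HasDerivWithinAt α (f t (α t)) (Set.Icc (-(n : ℝ)) n) t := by
    intro n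
    -- A field bounded by `M` moves a point by at most `M * n` in time `n`; with this radius no
    -- smallness of the time interval is needed.
    have hpl : IsPicardLindelof f (tmin := -(n : ℝ)) (tmax := n)
        ⟨0, by simp⟩ x₀ (M * n) 0 M K :=
      { lipschitzOnWith := fun t _ ↦ (hK t).lipschitzOnWith
        continuousOn := fun x _ ↦ (hc x).continuousOn
        norm_le := fun t _ x _ ↦ hM t x
        mul_max_le := by simp }
    exact hpl.exists_eq_forall_mem_Icc_hasDerivWithinAt₀
  choose β hβ0 hβ using hloc
  have hβ' : ∀ n : ℕ, ∀ t ∈ Set.Ioo (-(n : ℝ)) n, HasDerivAt (β n) (f t (β n t)) t :=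
    fun n t ht ↦ (hβ n t (Set.Ioo_subset_Icc_self ht)).hasDerivAt (Icc_mem_nhds ht.1 ht.2)
  have hmono : ∀ m n : ℕ, m ≤ n → ∀ t ∈ Set.Ioo (-(m : ℝ)) m, β m t = β n t := by
    intro m n hmn t ht
    have hmn' : (m : ℝ) ≤ n := by exact_mod_cast hmn
    refine ODE_solution_unique_of_mem_Ioo (v := f) (s := fun _ ↦ Set.univ) (K := K)
      (t₀ := 0) (fun t _ ↦ (hK t).lipschitzOnWith) ?_
      (fun t ht ↦ ⟨hβ' m t ht, trivial⟩)
      (fun t ht ↦ ⟨hβ' n t ⟨by linarith [ht.1], by linarith [ht.2]⟩, trivial⟩)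
      ((hβ0 m).trans (hβ0 n).symm) ht
    have h1 := ht.1.trans ht.2
    exact ⟨by linarith, by linarith⟩
  have hagree : ∀ m n : ℕ, ∀ t ∈ Set.Ioo (-(m : ℝ)) m, t ∈ Set.Ioo (-(n : ℝ)) n →
      β m t = β n t := by
    intro m n t hm hn
    rcases le_total m n with h | h
    · exact hmono m n h t hm
    · exact (hmono n m h t hn).symm
  have hmem : ∀ t : ℝ, t ∈ Set.Ioo (-((⌈|t|⌉₊ + 1 : ℕ) : ℝ)) ((⌈|t|⌉₊ + 1 : ℕ) : ℝ) := by
    intro t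
    have h : |t| < ((⌈|t|⌉₊ + 1 : ℕ) : ℝ) := by
      push_cast
      linarith [Nat.le_ceil |t|]
    exact abs_lt.mp h
  -- The `+ 1` puts `t` strictly inside an interval, so the glued curve coincides with a single `β
  -- n` near `t`.
  refine ⟨fun t ↦ β (⌈|t|⌉₊ + 1) t, hβ0 _, fun t ↦ ?_⟩
  refine (hβ' _ t (hmem t)).congr_of_eventuallyEq ?_
  filter_upwards [Ioo_mem_nhds (hmem t).1 (hmem t).2] with s hs
  exact hagree _ _ s (hmem s) hs

/-- Product rule for a bounded strongly continuous family of operators applied to a curve. -/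
theorem hasDerivAt_clm_apply_of_strong {E F : Type*} [NormedAddCommGroup E] [NormedSpace ℂ E]
    [NormedAddCommGroup F] [NormedSpace ℂ F] {T : ℝ → E →L[ℂ] F} {C : ℝ}
    (hC : ∀ t x, ‖T t x‖ ≤ C * ‖x‖) {v : ℝ → E} {v' : E} {w : F} {t : ℝ}
    (hT : ContinuousAt (fun s ↦ T s v') t) (hTv : HasDerivAt (fun s ↦ T s (v t)) w t)
    (hv : HasDerivAt v v' t) : HasDerivAt (fun s ↦ T s (v s)) (w + T t v') t := by
  rw [hasDerivAt_iff_isLittleO] at hTv hv ⊢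
  -- The remainder splits into `T s` applied to the remainder of `v`, the variation of `T` on the
  -- fixed vector `v'`, and the remainder of `s ↦ T s (v t)`. Norm continuity of `T` is never
  -- needed.
  have h1 : (fun s ↦ T s (v s - v t - (s - t) • v')) =o[𝓝 t] fun s ↦ s - t :=
    (Asymptotics.IsBigO.of_bound C (Eventually.of_forall fun s ↦ hC s _)).trans_isLittleO hv
  have h2 : (fun s ↦ (s - t) • (T s v' - T t v')) =o[𝓝 t] fun s ↦ s - t := by
    have : (fun s ↦ T s v' - T t v') =o[𝓝 t] fun _ ↦ (1 : ℝ) := by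
      rw [Asymptotics.isLittleO_one_iff]
      simpa using hT.tendsto.sub_const (T t v')
    simpa using (Asymptotics.isBigO_refl (fun s : ℝ ↦ s - t) (𝓝 t)).smul_isLittleO this
  refine ((h1.add h2).add hTv).congr_left fun s ↦ ?_
  simp only [map_sub, smul_add, smul_sub, ← Complex.coe_smul, map_smul]
  abel

/-! ### The interaction picture -/

theorem norm_freeCLM (t : ℝ) (u : L2) : ‖freeCLM t u‖ = ‖u‖ := by
  have h := inner_freeCLM t u u
  rw [inner_self_eq_norm_sq_to_K, inner_self_eq_norm_sq_to_K] at h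
  have h' : ‖freeCLM t u‖ ^ 2 = ‖u‖ ^ 2 := by
    apply Complex.ofReal_injective
    push_cast
    exact h
  exact (sq_eq_sq₀ (norm_nonneg _) (norm_nonneg _)).mp h'

theorem freeCLM_neg_freeCLM (t : ℝ) (u : L2) : freeCLM (-t) (freeCLM t u) = u := by
  rw [← freeCLM_add, neg_add_cancel, freeCLM_zero]

theorem freeCLM_freeCLM_neg (t : ℝ) (u : L2) : freeCLM t (freeCLM (-t) u) = u := by
  rw [← freeCLM_add, add_neg_cancel, freeCLM_zero]

theorem inner_freeCLM_left (t : ℝ) (u v : L2) :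
    (inner ℂ (freeCLM t u) v : ℂ) = inner ℂ u (freeCLM (-t) v) := by
  rw [← inner_freeCLM t u, freeCLM_freeCLM_neg]

theorem ContinuousOn.freeCLM_apply {v : ℝ → L2} {s : Set ℝ} (hv : ContinuousOn v s) :
    ContinuousOn (fun t ↦ freeCLM t (v t)) s := by
  intro t ht
  rw [ContinuousWithinAt, tendsto_iff_norm_sub_tendsto_zero]
  have h1 : Tendsto (fun s ↦ ‖v s - v t‖) (𝓝[s] t) (𝓝 0) :=
    tendsto_iff_norm_sub_tendsto_zero.mp (hv t ht)
  have h2 : Tendsto (fun s ↦ ‖freeCLM s (v t) - freeCLM t (v t)‖) (𝓝[s] t) (𝓝 0) :=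
    tendsto_iff_norm_sub_tendsto_zero.mp
      ((continuous_freeCLM (v t)).continuousWithinAt (s := s) (x := t))
  refine squeeze_zero (fun _ ↦ norm_nonneg _) (fun s ↦ ?_) (by simpa using h1.add h2)
  rw [← norm_freeCLM s (v s - v t), map_sub]
  exact norm_sub_le_norm_sub_add_norm_sub _ _ _

theorem Continuous.freeCLM_apply {v : ℝ → L2} (hv : Continuous v) :
    Continuous (fun t ↦ freeCLM t (v t)) := by
  rw [← continuousOn_univ]
  exact ContinuousOn.freeCLM_apply hv.continuousOn

section Profile

variable {R : L2} {Φ : ℝ → L2} {p : ℝ → ℂ}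

theorem hasDerivAt_resolvent_freeCLM
    (hΦ : ∀ t, HasDerivAt Φ ((-Complex.I * p t) • freeCLM (-t) R) t) (t : ℝ) :
    HasDerivAt (fun s ↦ resolvent (freeCLM s (Φ s)))
      (-Complex.I • laplaceResolvent (freeCLM t (Φ t)) + (-Complex.I * p t) • resolvent R) t := by
  have h := hasDerivAt_clm_apply_of_strong (T := fun s ↦ resolvent ∘L freeCLM s)
    (C := ‖resolvent‖) (w := -Complex.I • laplaceResolvent (freeCLM t (Φ t)))
    (fun s x ↦ by
      rw [← norm_freeCLM s x]
      exact resolvent.le_opNorm _)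
    (resolvent.continuous.comp (continuous_freeCLM _)).continuousAt
    (by
      simp only [ContinuousLinearMap.comp_apply, ← freeCLM_resolvent]
      exact hasDerivAt_freeCLM_resolvent t (Φ t)) (hΦ t)
  simp only [ContinuousLinearMap.comp_apply, map_smul, freeCLM_freeCLM_neg] at h
  exact h

theorem resolvent_freeCLM_eq_duhamel (hp : Continuous p)
    (hΦ : ∀ t, HasDerivAt Φ ((-Complex.I * p t) • freeCLM (-t) R) t) (t : ℝ) :
    resolvent (freeCLM t (Φ t)) = freeCLM t (resolvent (Φ 0)) -
      Complex.I • ∫ s in (0 : ℝ)..t, p s • freeCLM (t - s) (resolvent R) := by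
  have hcont : Continuous fun s ↦ (-Complex.I * p s) • freeCLM (-s) R :=
    (continuous_const.mul hp).smul ((continuous_freeCLM R).comp continuous_neg)
  have h := intervalIntegral.integral_eq_sub_of_hasDerivAt (a := 0) (b := t)
    (fun s _ ↦ hΦ s) (hcont.intervalIntegrable _ _)
  have h2 : Φ t = Φ 0 + ∫ s in (0 : ℝ)..t, (-Complex.I * p s) • freeCLM (-s) R := by
    rw [h]; abel
  have h3 := (resolvent ∘L freeCLM t).intervalIntegral_comp_comm
    (hcont.intervalIntegrable (μ := volume) 0 t)
  have h4 : resolvent (freeCLM t (∫ s in (0 : ℝ)..t, (-Complex.I * p s) • freeCLM (-s) R)) =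
      ∫ s in (0 : ℝ)..t, (-Complex.I * p s) • freeCLM (t - s) (resolvent R) := by
    rw [← ContinuousLinearMap.comp_apply, ← h3]
    refine intervalIntegral.integral_congr fun s _ ↦ ?_
    simp only [ContinuousLinearMap.comp_apply, map_smul]
    rw [← freeCLM_add, ← sub_eq_add_neg, freeCLM_resolvent]
  rw [h2, map_add, map_add, h4, ← freeCLM_resolvent, sub_eq_add_neg, ← neg_smul,
    ← intervalIntegral.integral_smul]
  simp only [smul_smul]

theorem hasDerivAt_norm_sq {E : Type*} [NormedAddCommGroup E] [InnerProductSpace ℂ E]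
    {v : ℝ → E} {v' : E} {t : ℝ} (hv : HasDerivAt v v' t) :
    HasDerivAt (fun s ↦ ‖v s‖ ^ 2) (2 * (inner ℂ (v t) v' : ℂ).re) t := by
  let : InnerProductSpace ℝ E := InnerProductSpace.rclikeToReal ℂ E
  exact hv.norm_sq

/-- The derivative of the squared norm is `2 Re(-i p q̄)`, zero when `p` is a real multiple of `q`.
The multiple is left arbitrary so that the retracted coupling is covered too. -/
theorem norm_resolvent_freeCLM_eq
    (hΦ : ∀ t, HasDerivAt Φ ((-Complex.I * p t) • freeCLM (-t) R) t)
    (hp : ∀ t, ∃ c : ℝ, p t = c * inner ℂ (resolvent R) (resolvent (freeCLM t (Φ t)))) (t : ℝ) :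
    ‖resolvent (freeCLM t (Φ t))‖ = ‖resolvent (Φ 0)‖ := by
  have hd : ∀ t, HasDerivAt (fun s ↦ ‖resolvent (Φ s)‖ ^ 2) 0 t := by
    intro t
    have h1 : HasDerivAt (fun s ↦ resolvent (Φ s))
        (resolvent ((-Complex.I * p t) • freeCLM (-t) R)) t :=
      (resolvent.restrictScalars ℝ).hasFDerivAt.comp_hasDerivAt t (hΦ t)
    convert hasDerivAt_norm_sq h1 using 1
    obtain ⟨c, hc⟩ := hp t
    rw [map_smul, inner_smul_right, ← freeCLM_resolvent, ← inner_freeCLM_left,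
      freeCLM_resolvent, ← inner_conj_symm (resolvent (freeCLM t (Φ t))), hc, mul_assoc, mul_assoc,
      Complex.mul_conj, ← Complex.ofReal_mul]
    simp
  have hconst := is_const_of_deriv_eq_zero (fun t ↦ (hd t).differentiableAt)
    (fun t ↦ (hd t).deriv) t 0
  rw [← freeCLM_resolvent, norm_freeCLM]
  exact (sq_eq_sq₀ (norm_nonneg _) (norm_nonneg _)).mp hconst

theorem hasDerivAt_gradNormSq
    (hΦ : ∀ t, HasDerivAt Φ ((-Complex.I * p t) • freeCLM (-t) R) t) (t : ℝ) :
    HasDerivAt (fun s ↦ gradNormSq (resolvent (freeCLM s (Φ s))))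
      (2 * (-Complex.I * p t *
        inner ℂ (laplaceResolvent (freeCLM t (Φ t))) (resolvent R)).re) t := by
  -- The group commutes with both multipliers and is unitary, so it drops out of the quadratic form
  -- and only `Φ` is differentiated.
  have h0 : ∀ s, gradNormSq (resolvent (freeCLM s (Φ s))) =
      (inner ℂ (resolvent (Φ s)) (laplaceResolvent (Φ s)) : ℂ).re := by
    intro s
    rw [gradNormSq_resolvent, ← freeCLM_resolvent, ← freeCLM_laplaceResolvent, inner_freeCLM]
  simp only [h0]
  have h1 : HasDerivAt (fun s ↦ resolvent (Φ s))
      (resolvent ((-Complex.I * p t) • freeCLM (-t) R)) t :=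
    (resolvent.restrictScalars ℝ).hasFDerivAt.comp_hasDerivAt t (hΦ t)
  have h2 : HasDerivAt (fun s ↦ laplaceResolvent (Φ s))
      (laplaceResolvent ((-Complex.I * p t) • freeCLM (-t) R)) t :=
    (laplaceResolvent.restrictScalars ℝ).hasFDerivAt.comp_hasDerivAt t (hΦ t)
  have h3 := Complex.reCLM.hasFDerivAt.comp_hasDerivAt t (h1.inner ℂ h2)
  refine h3.congr_deriv ?_
  rw [inner_resolvent_laplaceResolvent, ← inner_conj_symm (resolvent _) (laplaceResolvent (Φ t)),
    map_smul resolvent, inner_smul_right, ← freeCLM_resolvent, ← inner_freeCLM_left,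
    freeCLM_laplaceResolvent, Complex.reCLM_apply, Complex.add_re, Complex.conj_re]
  ring

/-- Conservation of energy for a general potential `W`. -/
theorem gradNormSq_add_eq
    (hΦ : ∀ t, HasDerivAt Φ ((-Complex.I * p t) • freeCLM (-t) R) t) {n : ℝ → ℝ} {W : ℝ → ℝ}
    (hp : ∀ t, p t = n t * inner ℂ (resolvent R) (resolvent (freeCLM t (Φ t))))
    (hW : ∀ t, HasDerivAt W (n t)
      (‖(inner ℂ (resolvent R) (resolvent (freeCLM t (Φ t))) : ℂ)‖ ^ 2)) (t : ℝ) :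
    gradNormSq (resolvent (freeCLM t (Φ t))) +
        W (‖(inner ℂ (resolvent R) (resolvent (freeCLM t (Φ t))) : ℂ)‖ ^ 2) =
      gradNormSq (resolvent (freeCLM 0 (Φ 0))) +
        W (‖(inner ℂ (resolvent R) (resolvent (freeCLM 0 (Φ 0))) : ℂ)‖ ^ 2) := by
  have hd : ∀ t, HasDerivAt (fun s ↦ gradNormSq (resolvent (freeCLM s (Φ s))) +
      W (‖(inner ℂ (resolvent R) (resolvent (freeCLM s (Φ s))) : ℂ)‖ ^ 2)) 0 t := by
    intro t
    have hq := ((innerSL ℂ (resolvent R)).restrictScalars ℝ).hasFDerivAt.comp_hasDerivAt t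
      (hasDerivAt_resolvent_freeCLM hΦ t)
    have h1 := (hW t).comp t (hasDerivAt_norm_sq hq)
    have h2 := (hasDerivAt_gradNormSq hΦ t).add h1
    refine h2.congr_deriv ?_
    simp only [Function.comp_apply, ContinuousLinearMap.coe_restrictScalars', innerSL_apply_apply,
      inner_add_right, inner_smul_right, hp]
    rw [← inner_conj_symm (laplaceResolvent (freeCLM t (Φ t))) (resolvent R),
      inner_self_eq_norm_sq_to_K]
    -- With `z = q` and `y = (ρ^ε, -Δψ)`, the gradient contributes `2n Im(z ȳ)` and the potential
    -- `2n Im(z̄ y)`, which cancel; the term with `b²` is purely imaginary before the real part is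
    -- taken.
    generalize (inner ℂ (resolvent R) (resolvent (freeCLM t (Φ t))) : ℂ) = z
    generalize (inner ℂ (resolvent R) (laplaceResolvent (freeCLM t (Φ t))) : ℂ) = y
    generalize ‖resolvent R‖ = b
    simp [← Complex.ofReal_pow]
    ring
  exact is_const_of_deriv_eq_zero (fun t ↦ (hd t).differentiableAt) (fun t ↦ (hd t).deriv) t 0

end Profile

/-! ### Existence and uniqueness -/

theorem exists_profile {N : ℂ → ℂ} {K : ℝ≥0} (hK : LipschitzWith K N) {M : ℝ≥0}
    (hM : ∀ z, ‖N z‖ ≤ M) (R Ψ₀ : L2) : ∃ Φ : ℝ → L2, Φ 0 = Ψ₀ ∧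
      ∀ t, HasDerivAt Φ ((-Complex.I *
        N (inner ℂ (resolvent R) (resolvent (freeCLM t (Φ t))))) • freeCLM (-t) R) t := by
  refine exists_hasDerivAt_of_lipschitz_of_bounded
    (f := fun t x ↦ (-Complex.I *
        N (inner ℂ (resolvent R) (resolvent (freeCLM t x)))) • freeCLM (-t) R)
    (K := K * ‖resolvent R‖₊ * ‖resolvent‖₊ * ‖R‖₊) (M := M * ‖R‖₊) (fun t ↦ ?_) (fun x ↦ ?_)
    (fun t x ↦ ?_) Ψ₀
  · refine LipschitzWith.of_dist_le_mul fun x y ↦ ?_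
    rw [dist_eq_norm, dist_eq_norm, ← sub_smul, ← mul_sub, norm_smul, norm_mul, norm_neg,
      Complex.norm_I, one_mul, norm_freeCLM]
    push_cast
    have h1 := hK.norm_sub_le (inner ℂ (resolvent R) (resolvent (freeCLM t x)))
      (inner ℂ (resolvent R) (resolvent (freeCLM t y)))
    rw [← inner_sub_right, ← map_sub, ← map_sub] at h1
    have h2 : ‖(inner ℂ (resolvent R) (resolvent (freeCLM t (x - y))) : ℂ)‖ ≤
        ‖resolvent R‖ * (‖resolvent‖ * ‖x - y‖) := by
      refine (norm_inner_le_norm _ _).trans ?_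
      gcongr
      rw [← norm_freeCLM t (x - y)]
      exact resolvent.le_opNorm _
    calc _ ≤ (K * (‖resolvent R‖ * (‖resolvent‖ * ‖x - y‖))) * ‖R‖ := by
          gcongr
          exact h1.trans (by gcongr)
      _ = _ := by ring
  · refine (continuous_const.mul (hK.continuous.comp ?_)).smul
      ((continuous_freeCLM R).comp continuous_neg)
    exact continuous_const.inner (resolvent.continuous.comp (continuous_freeCLM x))
  · rw [norm_smul, norm_mul, norm_neg, Complex.norm_I, one_mul, norm_freeCLM]
    push_cast
    gcongr
    exact hM _

/-- Only integrability of the Duhamel integrand is used, and nothing is assumed of `φ` at time `0`.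
-/
theorem eq_freeCLM_of_duhamel {N : ℂ → ℂ} {r ψ₀ : L2}
    (hN : ∀ B : ℝ, ∃ K : ℝ≥0, LipschitzOnWith K N (Metric.closedBall 0 B))
    {y : ℝ → L2} (hy0 : y 0 = ψ₀)
    (hy : ∀ t, HasDerivAt y ((-Complex.I * N (inner ℂ r (freeCLM t (y t)))) • freeCLM (-t) r) t)
    {T : ℝ} {φ : ℝ → L2}
    (hint : ∀ t ∈ Set.Ioo 0 T,
      IntervalIntegrable (fun s ↦ N (inner ℂ r (φ s)) • freeCLM (t - s) r) volume 0 t)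
    (hφ : ∀ t ∈ Set.Ioo 0 T, φ t = freeCLM t ψ₀ -
      Complex.I • ∫ s in (0 : ℝ)..t, N (inner ℂ r (φ s)) • freeCLM (t - s) r)
    {t : ℝ} (ht : t ∈ Set.Ioo 0 T) : φ t = freeCLM t (y t) := by
  have hNc : Continuous N := by
    rw [continuous_iff_continuousAt]
    intro z
    obtain ⟨K, hK⟩ := hN (‖z‖ + 1)
    refine hK.continuousOn.continuousAt (mem_of_superset (Metric.ball_mem_nhds z one_pos) ?_)
    intro w hw
    rw [mem_closedBall_zero_iff]
    have h1 := norm_sub_norm_le w z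
    have h2 := mem_ball_iff_norm.mp hw
    linarith
  set g : ℝ → L2 := fun s ↦ N (inner ℂ r (φ s)) • freeCLM (-s) r with hg
  have hcomp : ∀ a s : ℝ, freeCLM a (g s) = N (inner ℂ r (φ s)) • freeCLM (a - s) r := by
    intro a s
    rw [hg, map_smul, ← freeCLM_add, ← sub_eq_add_neg]
  have hgint : ∀ t ∈ Set.Ioo 0 T, IntervalIntegrable g volume 0 t := by
    intro a ha
    have h : ∀ s, freeCLM (-a) (N (inner ℂ r (φ s)) • freeCLM (a - s) r) = g s := fun s ↦ by
      rw [← hcomp, freeCLM_neg_freeCLM]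
    rw [← funext h]
    exact ⟨(freeCLM (-a)).integrable_comp (hint a ha).1,
      (freeCLM (-a)).integrable_comp (hint a ha).2⟩
  -- This is `U(-a) φ(a)` inside the interval, but as a primitive it is also continuous at `0`.
  -- Feeding it back into the integrand gives the continuous `k`, which agrees with `g` on `(0, t]`.
  set χ : ℝ → L2 := fun a ↦ ψ₀ - Complex.I • ∫ s in (0 : ℝ)..a, g s with hχ
  have hχφ : ∀ a ∈ Set.Ioo 0 T, freeCLM a (χ a) = φ a := by
    intro a ha
    rw [hφ a ha, hχ, map_sub, map_smul, ← (freeCLM a).intervalIntegral_comp_comm (hgint a ha)]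
    simp only [hcomp]
  have hχc : ContinuousOn χ (Set.Icc 0 t) := by
    have h := intervalIntegral.continuousOn_primitive_interval' (hgint t ht) Set.left_mem_uIcc
    rw [Set.uIcc_of_le ht.1.le] at h
    exact continuousOn_const.sub (h.const_smul Complex.I)
  set k : ℝ → L2 := fun s ↦ N (inner ℂ r (freeCLM s (χ s))) • freeCLM (-s) r with hk
  have hkc : ContinuousOn k (Set.Icc 0 t) := by
    refine ContinuousOn.smul (f := fun s ↦ N (inner ℂ r (freeCLM s (χ s))))
      (g := fun s ↦ freeCLM (-s) r) ?_ ((continuous_freeCLM r).comp continuous_neg).continuousOn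
    exact hNc.comp_continuousOn (continuousOn_const.inner (ContinuousOn.freeCLM_apply hχc))
  -- A continuous extension to the whole line makes the primitive differentiable everywhere,
  -- endpoints included.
  set k' : ℝ → L2 := Set.IccExtend ht.1.le ((Set.Icc 0 t).domRestrict k) with hk'
  have hk'c : Continuous k' := hkc.domRestrict.Icc_extend'
  have hk'eq : ∀ s ∈ Set.Icc 0 t, k' s = k s := fun s hs ↦ by
    rw [hk', Set.IccExtend_of_mem _ _ hs, Set.domRestrict_apply]
  set z : ℝ → L2 := fun a ↦ ψ₀ - Complex.I • ∫ s in (0 : ℝ)..a, k' s with hz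
  have hzχ : ∀ a ∈ Set.Icc 0 t, z a = χ a := by
    intro a ha
    simp only [hz, hχ]
    congr 2
    refine intervalIntegral.integral_congr_ae (ae_of_all _ fun s hs ↦ ?_)
    rw [Set.uIoc_of_le ha.1] at hs
    rw [hk'eq s ⟨hs.1.le, hs.2.trans ha.2⟩]
    simp only [hk, hg, hχφ s ⟨hs.1, (hs.2.trans ha.2).trans_lt ht.2⟩]
  have hzd : ∀ a, HasDerivAt z (-(Complex.I • k' a)) a := fun a ↦
    ((intervalIntegral.integral_hasDerivAt_right (hk'c.intervalIntegrable _ _)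
      (hk'c.stronglyMeasurableAtFilter _ _) hk'c.continuousAt).const_smul Complex.I).const_sub ψ₀
  have hzc : Continuous z := continuous_iff_continuousAt.mpr fun a ↦ (hzd a).continuousAt
  have hyc : Continuous y := continuous_iff_continuousAt.mpr fun a ↦ (hy a).continuousAt
  obtain ⟨B₁, hB₁⟩ := (isCompact_Icc (a := (0 : ℝ)) (b := t)).exists_bound_of_continuousOn
    hzc.continuousOn
  obtain ⟨B₂, hB₂⟩ := (isCompact_Icc (a := (0 : ℝ)) (b := t)).exists_bound_of_continuousOn
    hyc.continuousOn
  set B := max B₁ B₂ with hB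
  obtain ⟨K, hK⟩ := hN (‖r‖ * B)
  have heq : Set.EqOn z y (Set.Icc 0 t) := by
    refine ODE_solution_unique_of_mem_Icc_right
      (v := fun t x ↦ (-Complex.I * N (inner ℂ r (freeCLM t x))) • freeCLM (-t) r)
      (s := fun _ ↦ Metric.closedBall 0 B) (K := K * ‖r‖₊ * ‖r‖₊) ?_ hzc.continuousOn ?_ ?_
      hyc.continuousOn (fun a _ ↦ (hy a).hasDerivWithinAt) ?_ ?_
    · intro a _
      refine LipschitzOnWith.of_dist_le_mul fun u hu w hw ↦ ?_
      have hmem : ∀ u ∈ Metric.closedBall (0 : L2) B,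
          (inner ℂ r (freeCLM a u) : ℂ) ∈ Metric.closedBall (0 : ℂ) (‖r‖ * B) := by
        intro u hu
        rw [mem_closedBall_zero_iff] at hu ⊢
        refine (norm_inner_le_norm _ _).trans ?_
        rw [norm_freeCLM]
        gcongr
      rw [dist_eq_norm, dist_eq_norm, ← sub_smul, ← mul_sub, norm_smul, norm_mul, norm_neg,
        Complex.norm_I, one_mul, norm_freeCLM]
      push_cast
      have h1 := hK.norm_sub_le (hmem u hu) (hmem w hw)
      rw [← inner_sub_right, ← map_sub] at h1
      have h2 : ‖(inner ℂ r (freeCLM a (u - w)) : ℂ)‖ ≤ ‖r‖ * ‖u - w‖ := by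
        refine (norm_inner_le_norm _ _).trans ?_
        rw [norm_freeCLM]
      calc _ ≤ (K * (‖r‖ * ‖u - w‖)) * ‖r‖ := by
            gcongr
            exact h1.trans (by gcongr)
        _ = _ := by ring
    · intro a ha
      have ha' := Set.Ico_subset_Icc_self ha
      have h := (hzd a).hasDerivWithinAt (s := Set.Ici a)
      rw [hk'eq a ha', hk] at h
      simp only [← hzχ a ha'] at h
      rwa [smul_smul, ← neg_smul, ← neg_mul] at h
    · intro a ha
      rw [mem_closedBall_zero_iff]
      exact (hB₁ a (Set.Ico_subset_Icc_self ha)).trans (le_max_left _ _)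
    · intro a ha
      rw [mem_closedBall_zero_iff]
      exact (hB₂ a (Set.Ico_subset_Icc_self ha)).trans (le_max_right _ _)
    · simp [hz, hy0]
  have hmt : t ∈ Set.Icc 0 t := ⟨ht.1.le, le_rfl⟩
  rw [← hχφ t ht, ← hzχ t hmt, heq hmt]

/-! ### The nonlinearity -/

/-- Bernoulli's inequality for `(t / s) ^ (p + 1)`. The factor `t` makes up for `r ↦ r ^ p` failing
to be Lipschitz at `0` when `0 < p < 1`. -/
theorem rpow_sub_rpow_mul_le {p s t : ℝ} (hp : 0 ≤ p) (ht : 0 ≤ t) (hts : t ≤ s) :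
    (s ^ p - t ^ p) * t ≤ (p + 1) * s ^ p * (s - t) := by
  rcases (ht.trans hts).eq_or_lt with rfl | hs
  · obtain rfl : t = 0 := le_antisymm hts ht
    simp
  have h1 := one_add_mul_self_le_rpow_one_add (s := t / s - 1) (p := p + 1)
    (by linarith [div_nonneg ht hs.le]) (by linarith)
  rw [add_sub_cancel, Real.div_rpow ht hs.le, le_div_iff₀ (by positivity),
    Real.rpow_add_one hs.ne', Real.rpow_add_one' ht (by linarith)] at h1
  have h2 : (1 + (p + 1) * (t / s - 1)) * (s ^ p * s) =
      s ^ p * s - (p + 1) * s ^ p * (s - t) := by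
    field_simp
    ring
  rw [h2] at h1
  have h3 : s ^ p * t ≤ s ^ p * s := by gcongr
  linarith

/-- `z ↦ |z|^p z` is locally Lipschitz for `p ≥ 0`. -/
theorem norm_rpow_mul_sub_rpow_mul_le {p B : ℝ} (hp : 0 ≤ p) {z w : ℂ} (hz : ‖z‖ ≤ B)
    (hw : ‖w‖ ≤ B) :
    ‖((‖z‖ ^ p : ℝ) : ℂ) * z - ((‖w‖ ^ p : ℝ) : ℂ) * w‖ ≤ (p + 2) * B ^ p * ‖z - w‖ := by
  wlog h : ‖w‖ ≤ ‖z‖ generalizing z w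
  · rw [norm_sub_rev, norm_sub_rev z]
    exact this hw hz (le_of_not_ge h)
  have h1 : ((‖z‖ ^ p : ℝ) : ℂ) * z - ((‖w‖ ^ p : ℝ) : ℂ) * w =
      ((‖z‖ ^ p : ℝ) : ℂ) * (z - w) + ((‖z‖ ^ p - ‖w‖ ^ p : ℝ) : ℂ) * w := by
    push_cast
    ring
  have h2 : ‖w‖ ^ p ≤ ‖z‖ ^ p := by gcongr
  rw [h1]
  refine (norm_add_le _ _).trans ?_
  rw [norm_mul, norm_mul, Complex.norm_real, Complex.norm_real,
    Real.norm_of_nonneg (by positivity), Real.norm_of_nonneg (sub_nonneg.mpr h2)]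
  calc ‖z‖ ^ p * ‖z - w‖ + (‖z‖ ^ p - ‖w‖ ^ p) * ‖w‖
      ≤ ‖z‖ ^ p * ‖z - w‖ + (p + 1) * ‖z‖ ^ p * (‖z‖ - ‖w‖) := by
        exact add_le_add le_rfl (rpow_sub_rpow_mul_le hp (norm_nonneg w) h)
    _ ≤ ‖z‖ ^ p * ‖z - w‖ + (p + 1) * ‖z‖ ^ p * ‖z - w‖ := by
        gcongr
        exact norm_sub_norm_le z w
    _ = (p + 2) * ‖z‖ ^ p * ‖z - w‖ := by ring
    _ ≤ (p + 2) * B ^ p * ‖z - w‖ := by gcongr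

/-- The retraction of `ℂ` onto the closed ball of radius `B` along rays. -/
def radialRetraction (B : ℝ) (z : ℂ) : ℂ := ((B / max B ‖z‖ : ℝ) : ℂ) * z

theorem radialRetraction_of_norm_le {B : ℝ} (hB : 0 < B) {z : ℂ} (hz : ‖z‖ ≤ B) :
    radialRetraction B z = z := by
  rw [radialRetraction, max_eq_left hz, div_self hB.ne', Complex.ofReal_one, one_mul]

theorem norm_radialRetraction_le {B : ℝ} (hB : 0 < B) (z : ℂ) : ‖radialRetraction B z‖ ≤ B := by
  have hm : 0 < max B ‖z‖ := lt_max_of_lt_left hB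
  rw [radialRetraction, norm_mul, Complex.norm_real, Real.norm_of_nonneg (by positivity),
    div_mul_eq_mul_div, div_le_iff₀ hm]
  gcongr
  exact le_max_right _ _

theorem lipschitzWith_radialRetraction {B : ℝ} (hB : 0 < B) :
    LipschitzWith 2 (radialRetraction B) := by
  refine LipschitzWith.of_dist_le_mul fun z w ↦ ?_
  rw [dist_eq_norm, dist_eq_norm, NNReal.coe_ofNat]
  have hz : 0 < max B ‖z‖ := lt_max_of_lt_left hB
  have hw : 0 < max B ‖w‖ := lt_max_of_lt_left hB
  have h1 : radialRetraction B z - radialRetraction B w =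
      ((B / max B ‖z‖ : ℝ) : ℂ) * (z - w) +
        ((B / max B ‖z‖ * ((max B ‖w‖ - max B ‖z‖) / max B ‖w‖) : ℝ) : ℂ) * w := by
    have h2 : B / max B ‖z‖ * ((max B ‖w‖ - max B ‖z‖) / max B ‖w‖) =
        B / max B ‖z‖ - B / max B ‖w‖ := by
      field_simp
    rw [h2, radialRetraction, radialRetraction]
    push_cast
    ring
  have h3 : B / max B ‖z‖ ≤ 1 := by
    rw [div_le_one hz]
    exact le_max_left _ _
  have h4 : |max B ‖w‖ - max B ‖z‖| ≤ ‖z - w‖ := by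
    refine (abs_max_sub_max_le_max _ _ _ _).trans ?_
    rw [sub_self, abs_zero, max_eq_right (abs_nonneg _), norm_sub_rev]
    exact abs_norm_sub_norm_le _ _
  have h5 : |max B ‖w‖ - max B ‖z‖| / max B ‖w‖ * ‖w‖ ≤ |max B ‖w‖ - max B ‖z‖| := by
    rw [div_mul_eq_mul_div, div_le_iff₀ hw]
    gcongr
    exact le_max_right _ _
  rw [h1]
  refine (norm_add_le _ _).trans ?_
  rw [norm_mul, norm_mul, Complex.norm_real, Complex.norm_real, norm_mul,
    Real.norm_of_nonneg (by positivity : 0 ≤ B / max B ‖z‖), Real.norm_eq_abs, abs_div,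
    abs_of_pos hw, mul_assoc]
  have h6 : B / max B ‖z‖ * ‖z - w‖ ≤ 1 * ‖z - w‖ := by gcongr
  have h7 : B / max B ‖z‖ * (|max B ‖w‖ - max B ‖z‖| / max B ‖w‖ * ‖w‖) ≤ 1 * ‖z - w‖ := by
    gcongr
    exact h5.trans h4
  linarith

section Coupling

variable (ρ : 𝓢(E3, ℝ)) (γ μ ε : ℝ)

/-- The real factor `(ε/ℓ)(-1 + γ ε^{1+2μ} |z|^{2μ} / ℓ^{2μ+1})`. -/
def couplingFactor (z : ℂ) : ℝ :=
  ε / ell ρ * (-1 + γ * (ε ^ (1 + 2 * μ) * ‖z‖ ^ (2 * μ) / ell ρ ^ (2 * μ + 1)))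

/-- The nonlinearity multiplied by `ε/ℓ`. -/
def coupling (z : ℂ) : ℂ := ((ε / ell ρ : ℝ) : ℂ) * nonlinearity ρ γ μ ε z

theorem coupling_eq (z : ℂ) : coupling ρ γ μ ε z = (couplingFactor ρ γ μ ε z : ℂ) * z := by
  rw [coupling, nonlinearity, couplingFactor, Complex.ofReal_mul, mul_assoc]

variable {μ}

theorem exists_lipschitzOnWith_coupling (hμ : 0 ≤ μ) (B : ℝ) :
    ∃ K : ℝ≥0, LipschitzOnWith K (coupling ρ γ μ ε) (Metric.closedBall 0 B) := by
  set a := ε / ell ρ with ha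
  set b := ε / ell ρ * γ * (ε ^ (1 + 2 * μ) / ell ρ ^ (2 * μ + 1)) with hb
  refine ⟨_, LipschitzOnWith.of_dist_le' (K := |a| + |b| * ((2 * μ + 2) * B ^ (2 * μ)))
    fun z hz w hw ↦ ?_⟩
  rw [mem_closedBall_zero_iff] at hz hw
  rw [dist_eq_norm, dist_eq_norm]
  have h : coupling ρ γ μ ε z - coupling ρ γ μ ε w = ((-a : ℝ) : ℂ) * (z - w) +
      (b : ℂ) * (((‖z‖ ^ (2 * μ) : ℝ) : ℂ) * z - ((‖w‖ ^ (2 * μ) : ℝ) : ℂ) * w) := by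
    rw [coupling_eq, coupling_eq, couplingFactor, couplingFactor, hb, ha]
    push_cast
    ring
  rw [h]
  refine (norm_add_le _ _).trans ?_
  rw [norm_mul, norm_mul, Complex.norm_real, Complex.norm_real, norm_neg, Real.norm_eq_abs,
    Real.norm_eq_abs, add_mul, mul_assoc |b|]
  gcongr
  exact norm_rpow_mul_sub_rpow_mul_le (by positivity) hz hw

variable {ρ} in
theorem ell_nonneg (hρ : ∀ x, 0 ≤ ρ x) : 0 ≤ ell ρ :=
  integral_nonneg fun x ↦ mul_nonneg (hρ x) <| integral_nonneg fun y ↦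
    mul_nonneg (by unfold newtonKernel; positivity) (hρ y)

/-- The potential part of the energy as a function of `|(ρ^ε, ψ)|²`. -/
def potential (μ : ℝ) (s : ℝ) : ℝ :=
  -(ε / ell ρ) * s + γ / (μ + 1) * (ε ^ (2 + 2 * μ) / ell ρ ^ (2 + 2 * μ)) * s ^ (1 + μ)

theorem energy_eq (u : L2) : energy ρ γ μ ε u =
    gradNormSq u + potential ρ γ ε μ (‖pairing ρ ε u‖ ^ 2) := by
  have h : ‖pairing ρ ε u‖ ^ (2 + 2 * μ) = (‖pairing ρ ε u‖ ^ 2) ^ (1 + μ) := by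
    rw [← Real.rpow_natCast_mul (norm_nonneg _)]
    congr 1
    push_cast
    ring
  rw [energy, potential, h]
  ring

variable {ρ ε} in
theorem hasDerivAt_potential (hρ : ∀ x, 0 ≤ ρ x) (hε : 0 < ε) (hμ : 0 ≤ μ) (z : ℂ) :
    HasDerivAt (potential ρ γ ε μ) (couplingFactor ρ γ μ ε z) (‖z‖ ^ 2) := by
  -- The exponent is at least `1`, so `z = 0` is allowed.
  have h1 := Real.hasDerivAt_rpow_const (x := ‖z‖ ^ 2) (p := 1 + μ) (Or.inr (by linarith))
  have h2 := ((hasDerivAt_id (‖z‖ ^ 2)).const_mul (-(ε / ell ρ))).add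
    (h1.const_mul (γ / (μ + 1) * (ε ^ (2 + 2 * μ) / ell ρ ^ (2 + 2 * μ))))
  refine h2.congr_deriv ?_
  have h3 : (‖z‖ ^ 2) ^ (1 + μ - 1) = ‖z‖ ^ (2 * μ) := by
    rw [← Real.rpow_natCast_mul (norm_nonneg _)]
    congr 1
    push_cast
    ring
  have h4 : ell ρ ^ (2 + 2 * μ) = ell ρ ^ (2 * μ + 1) * ell ρ := by
    rw [← Real.rpow_add_one' (ell_nonneg hρ) (by linarith)]
    congr 1
    ring
  have h5 : ε ^ (2 + 2 * μ) = ε ^ (1 + 2 * μ) * ε := by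
    rw [← Real.rpow_add_one hε.ne']
    congr 1
    ring
  have h6 : μ + 1 ≠ 0 := by linarith
  rw [couplingFactor, h3, h4, h5]
  have h7 : γ / (μ + 1) * (ε ^ (1 + 2 * μ) * ε / (ell ρ ^ (2 * μ + 1) * ell ρ)) *
      ((1 + μ) * ‖z‖ ^ (2 * μ)) = γ * ((ε ^ (1 + 2 * μ) * ε) /
        (ell ρ ^ (2 * μ + 1) * ell ρ)) * ‖z‖ ^ (2 * μ) * ((μ + 1) / (μ + 1)) := by ring
  rw [h7, div_self h6]
  simp only [div_eq_mul_inv, mul_inv]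
  ring

end Coupling

theorem memH2_scaledL2 (ρ : 𝓢(E3, ℝ)) {ε : ℝ} (hε : 0 < ε) : MemH2 (scaledL2 ρ ε) := by
  set S : 𝓢(E3, ℂ) := ((1 / ε ^ 3 : ℝ) : ℂ) • SchwartzMap.postcompCLM Complex.ofRealCLM
    (SchwartzMap.compCLMOfContinuousLinearEquiv ℝ
      (ContinuousLinearEquiv.smulLeft (Units.mk0 ε⁻¹ (inv_ne_zero hε.ne')) : E3 ≃L[ℝ] E3) ρ)
    with hS
  have h : scaledL2 ρ ε = S.toLp 2 := by
    refine MemLp.toLp_congr _ _ (ae_of_all _ fun x ↦ ?_)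
    simp only [hS, scaledFactor, Complex.ofReal_mul]
    rfl
  rw [MemH2, h, Lp.toTemperedDistribution_toLp_eq]
  exact SchwartzMap.memSobolev (s := 2) (p := 2) S

/-! ### Well-posedness -/

/-- Global regularity of the curve associated with a profile that satisfies the equation in the
interaction picture. -/
theorem isSolutionOn_of_profile {ρ : 𝓢(E3, ℝ)} {γ μ ε : ℝ} (hμ : 0 ≤ μ) {R : L2}
    (hR : resolvent R = scaledL2 ρ ε) {Φ : ℝ → L2}
    (hΦ : ∀ t, HasDerivAt Φ ((-Complex.I *
      coupling ρ γ μ ε (pairing ρ ε (resolvent (freeCLM t (Φ t))))) • freeCLM (-t) R) t)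
    (J : Set ℝ) :
    IsSolutionOn ρ γ μ ε (resolvent (Φ 0)) J fun t ↦ resolvent (freeCLM t (Φ t)) := by
  have hΦc : Continuous Φ := continuous_iff_continuousAt.mpr fun t ↦ (hΦ t).continuousAt
  have hΨc : Continuous fun t ↦ freeCLM t (Φ t) := Continuous.freeCLM_apply hΦc
  have hqc : Continuous fun t ↦ pairing ρ ε (resolvent (freeCLM t (Φ t))) :=
    continuous_const.inner (resolvent.continuous.comp hΨc)
  have hnc : Continuous (nonlinearity ρ γ μ ε) := by
    unfold nonlinearity
    have : Continuous fun z : ℂ ↦ ‖z‖ ^ (2 * μ) :=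
      continuous_norm.rpow_const fun _ ↦ Or.inr (by positivity)
    fun_prop
  have hpc : Continuous fun t ↦ coupling ρ γ μ ε (pairing ρ ε (resolvent (freeCLM t (Φ t)))) :=
    continuous_const.mul (hnc.comp hqc)
  have hd := hasDerivAt_resolvent_freeCLM hΦ
  refine ⟨⟨fun t ↦ freeCLM t (Φ t), hΨc.continuousOn, fun t _ ↦ besselPotential_resolvent _⟩,
    ?_, fun t _ ↦ ?_, fun t _ ↦ ?_⟩
  · refine ContDiff.contDiffOn (contDiff_one_iff_deriv.mpr
      ⟨fun t ↦ (hd t).differentiableAt, ?_⟩)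
    rw [funext fun t ↦ (hd t).deriv]
    exact ((laplaceResolvent.continuous.comp hΨc).const_smul (-Complex.I)).add
      ((continuous_const.mul hpc).smul continuous_const)
  · exact ((hnc.comp hqc).smul
      ((continuous_freeCLM (scaledL2 ρ ε)).comp (continuous_const.sub continuous_id))).intervalIntegrable
        _ _
  · have h := resolvent_freeCLM_eq_duhamel hpc hΦ t
    simp only [coupling, hR, mul_smul ((ε / ell ρ : ℝ) : ℂ)] at h
    rw [intervalIntegral.integral_smul, ← mul_smul] at h
    -- `freeCLM` unfolds to `freeGroup`.
    exact h

theorem exists_profile_coupling {ρ : 𝓢(E3, ℝ)} {γ μ ε : ℝ} (hμ : 0 ≤ μ) {R : L2}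
    (hR : resolvent R = scaledL2 ρ ε) (Ψ₀ : L2) : ∃ Φ : ℝ → L2, Φ 0 = Ψ₀ ∧
      (∀ t, HasDerivAt Φ ((-Complex.I *
        coupling ρ γ μ ε (pairing ρ ε (resolvent (freeCLM t (Φ t))))) • freeCLM (-t) R) t) ∧
      ∀ t, ‖resolvent (freeCLM t (Φ t))‖ = ‖resolvent Ψ₀‖ := by
  -- The Cauchy-Schwarz bound on `|q|` under conservation of mass; the `+ 1` makes the radius
  -- positive.
  set B := ‖resolvent R‖ * ‖resolvent Ψ₀‖ + 1 with hBdef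
  have hB : 0 < B := by positivity
  obtain ⟨K, hK⟩ := exists_lipschitzOnWith_coupling ρ γ ε hμ B
  have hmem : ∀ z, radialRetraction B z ∈ Metric.closedBall (0 : ℂ) B := fun z ↦
    mem_closedBall_zero_iff.mpr (norm_radialRetraction_le hB z)
  have hLip : LipschitzWith (K * 2) fun z ↦ coupling ρ γ μ ε (radialRetraction B z) := by
    have h := hK.comp ((lipschitzWith_radialRetraction hB).lipschitzOnWith (s := Set.univ))
      fun z _ ↦ hmem z
    exact lipschitzOnWith_univ.mp h
  have hbdd : ∀ z, ‖coupling ρ γ μ ε (radialRetraction B z)‖ ≤ (K * B.toNNReal : ℝ≥0) := by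
    intro z
    have h0 : coupling ρ γ μ ε 0 = 0 := by rw [coupling_eq, mul_zero]
    have h := hK.norm_sub_le (hmem z) (Metric.mem_closedBall_self hB.le)
    rw [h0, sub_zero, sub_zero] at h
    rw [NNReal.coe_mul, Real.coe_toNNReal _ hB.le]
    exact h.trans (by gcongr; exact norm_radialRetraction_le hB z)
  obtain ⟨Φ, hΦ0, hΦ⟩ := exists_profile hLip hbdd R Ψ₀
  have hmass : ∀ t, ‖resolvent (freeCLM t (Φ t))‖ = ‖resolvent Ψ₀‖ := by
    intro t
    rw [norm_resolvent_freeCLM_eq hΦ (fun t ↦ ?_) t, hΦ0]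
    set z : ℂ := inner ℂ (resolvent R) (resolvent (freeCLM t (Φ t)))
    -- The retraction moves along rays, so the retracted coupling at `z` is still a real multiple of
    -- `z`.
    refine ⟨couplingFactor ρ γ μ ε (radialRetraction B z) * (B / max B ‖z‖), ?_⟩
    rw [coupling_eq, Complex.ofReal_mul, mul_assoc]
    rfl
  refine ⟨Φ, hΦ0, fun t ↦ ?_, hmass⟩
  have h := hΦ t
  rw [radialRetraction_of_norm_le hB] at h
  · rw [pairing, ← hR]
    exact h
  · refine (norm_inner_le_norm _ _).trans ?_
    rw [hmass, hBdef]
    linarith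

theorem IsSolutionOn.eqOn_of_profile {ρ : 𝓢(E3, ℝ)} {γ μ ε : ℝ} (hμ : 0 ≤ μ) {R : L2}
    (hR : resolvent R = scaledL2 ρ ε) {Φ : ℝ → L2}
    (hΦ : ∀ t, HasDerivAt Φ ((-Complex.I *
      coupling ρ γ μ ε (pairing ρ ε (resolvent (freeCLM t (Φ t))))) • freeCLM (-t) R) t)
    {T : ℝ} {φ : ℝ → L2} (hφ : IsSolutionOn ρ γ μ ε (resolvent (Φ 0)) (Set.Ioo 0 T) φ) :
    Set.EqOn φ (fun t ↦ resolvent (freeCLM t (Φ t))) (Set.Ioo 0 T) := by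
  intro t ht
  have hy : ∀ t, HasDerivAt (fun s ↦ resolvent (Φ s)) ((-Complex.I * coupling ρ γ μ ε
      (inner ℂ (scaledL2 ρ ε) (freeCLM t (resolvent (Φ t))))) • freeCLM (-t) (scaledL2 ρ ε)) t := by
    intro t
    have h := (resolvent.restrictScalars ℝ).hasFDerivAt.comp_hasDerivAt t (hΦ t)
    refine HasDerivAt.congr_deriv h ?_
    rw [ContinuousLinearMap.coe_restrictScalars', map_smul, ← freeCLM_resolvent,
      ← freeCLM_resolvent, hR]
    rfl
  change φ t = resolvent (freeCLM t (Φ t))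
  rw [← freeCLM_resolvent]
  refine eq_freeCLM_of_duhamel (exists_lipschitzOnWith_coupling ρ γ ε hμ) rfl hy
    (fun s hs ↦ ?_) (fun s hs ↦ ?_) ht
  · have h := (hφ.intervalIntegrable s hs).smul (((ε / ell ρ : ℝ) : ℂ))
    exact h.congr fun x _ ↦ smul_smul _ _ _
  · rw [hφ.integral_eq s hs, mul_smul, ← intervalIntegral.integral_smul]
    simp only [smul_smul]
    rfl

end ScaledNLS

end

theorem theorem4p2 (ρ : 𝓢(ScaledNLS.E3, ℝ)) (hρ_nonneg : ∀ x, 0 ≤ ρ x)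
    (hρ_symm : ∀ x y, ‖x‖ = ‖y‖ → ρ x = ρ y) (hρ_int : ∫ x, ρ x = 1)
    (γ μ ε : ℝ) (hμ : 0 ≤ μ) (hε : 0 < ε)
    (ψ₀ : ScaledNLS.L2) (hψ₀ : ScaledNLS.MemH2 ψ₀) :
    ∃ ψ : ℝ → ScaledNLS.L2,
      -- one solution for all times, regular up to the initial time
      ScaledNLS.IsSolutionOn ρ γ μ ε ψ₀ (Set.Ici 0) ψ ∧
      ψ 0 = ψ₀ ∧
      -- for every `T` it is the unique solution in `C((0,T), H²) ∩ C¹((0,T), L²)`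
      (∀ T : ℝ, 0 < T →
        ScaledNLS.IsSolutionOn ρ γ μ ε ψ₀ (Set.Ioo 0 T) ψ ∧
        ∀ φ : ℝ → ScaledNLS.L2, ScaledNLS.IsSolutionOn ρ γ μ ε ψ₀ (Set.Ioo 0 T) φ →
          Set.EqOn φ ψ (Set.Ioo 0 T)) ∧
      -- it solves the differential equation `i ∂ₜψ = -Δψ + (ε/ℓ)(…)(ρ^ε,ψ) ρ^ε`
      (∀ t : ℝ, 0 ≤ t →
        ((Complex.I • derivWithin ψ (Set.Ici 0) t : ScaledNLS.L2) : 𝓢'(ScaledNLS.E3, ℂ)) =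
          -Δ (ψ t : 𝓢'(ScaledNLS.E3, ℂ)) +
            (((((ε / ScaledNLS.ell ρ : ℝ) : ℂ) *
              ScaledNLS.nonlinearity ρ γ μ ε (ScaledNLS.pairing ρ ε (ψ t))) •
                ScaledNLS.scaledL2 ρ ε : ScaledNLS.L2) : 𝓢'(ScaledNLS.E3, ℂ))) ∧
      -- mass and energy are conserved
      (∀ t : ℝ, 0 ≤ t →
        ScaledNLS.mass (ψ t) = ScaledNLS.mass ψ₀ ∧
        ScaledNLS.energy ρ γ μ ε (ψ t) = ScaledNLS.energy ρ γ μ ε ψ₀) := by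
  obtain ⟨R, hR⟩ := (ScaledNLS.memH2_scaledL2 ρ hε).exists_resolvent_eq
  obtain ⟨Ψ₀, rfl⟩ := hψ₀.exists_resolvent_eq
  obtain ⟨Φ, rfl, hΦ, hmass⟩ := ScaledNLS.exists_profile_coupling (γ := γ) hμ hR Ψ₀
  have hsol := ScaledNLS.isSolutionOn_of_profile hμ hR hΦ
  have h0 : ScaledNLS.resolvent (ScaledNLS.freeCLM 0 (Φ 0)) = ScaledNLS.resolvent (Φ 0) := by
    rw [ScaledNLS.freeCLM_zero]
  refine ⟨fun t ↦ ScaledNLS.resolvent (ScaledNLS.freeCLM t (Φ t)), hsol _, h0,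
    fun T _ ↦ ⟨hsol _, fun φ hφ ↦ hφ.eqOn_of_profile hμ hR hΦ⟩, fun t ht ↦ ?_, fun t _ ↦ ⟨?_, ?_⟩⟩
  · have hd : derivWithin (fun t ↦ ScaledNLS.resolvent (ScaledNLS.freeCLM t (Φ t)))
        (Set.Ici 0) t = _ := (ScaledNLS.hasDerivAt_resolvent_freeCLM hΦ t).hasDerivWithinAt.derivWithin
      (uniqueDiffOn_Ici 0 t ht)
    rw [hd, ScaledNLS.laplacian_resolvent, smul_add, smul_smul, smul_smul, ← mul_assoc, mul_neg,
      Complex.I_mul_I, neg_neg, one_smul, one_mul, hR]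
    exact map_add (Lp.toTemperedDistributionCLM ℂ volume 2) _ _
  · rw [ScaledNLS.mass, hmass, ScaledNLS.mass]
  · rw [ScaledNLS.energy_eq, ScaledNLS.energy_eq, ← h0, ScaledNLS.pairing, ScaledNLS.pairing, ← hR]
    refine ScaledNLS.gradNormSq_add_eq hΦ (fun t ↦ ?_)
      (fun t ↦ ScaledNLS.hasDerivAt_potential γ hρ_nonneg hε hμ _) t
    rw [ScaledNLS.coupling_eq, ScaledNLS.pairing, ← hR]
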